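/- Let $X$ be a Hausdorff, path-connected, locally path-connected and semi-locally simply connected topological space, and for a space $Y$ let $\mathcal{C}(Y)$ be the ring of continuous functions $Y\to\mathbb{C}$. Let $f\in\mathcal{C}(X)[z]$ be a Weierstrass polynomial of degree $n$ on $X$, i.e. $f$ is monic of degree $n$ and for every $x\in X$ the polynomial $f_x(z)\in\mathbb{C}[z]$ obtained by evaluating the coefficients at $x$ has $n$ distinct roots. For a continuous map $p:Y\to X$ write $p^*\gamma=\gamma\circ p$ for $\gamma\in\mathcal{C}(X)$, let $p^*f\in\mathcal{C}(Y)[z]$ be obtained by applying $p^*$ to the coefficients of $f$, and say that $f$ splits in $Y$ if there are $n$ distinct continuous functions $\beta:Y\to\mathbb{C}$ with $(p^*f)_y(\beta(y))=0$ for all $y\in Y$ (such a $\beta$ is called a root of $f$ in $Y$). Let $q:E_f\to X$ be the splitting covering of $f$, i.e. a covering with $E_f$ path-connected such that $f$ splits in $E_f$ and such that for every covering $p:Y\to X$ with $Y$ path-connected in which $f$ splits there is a covering map $\pi:Y\to E_f$ with $q\circ\pi=p$. Let $\alpha_1,\dots,\alpha_n:E_f\to\mathbb{C}$ be the $n$ distinct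 roots of $f$ in $E_f$. Let $q^*\mathcal{C}(X)=\{\gamma\circ q:\gamma\in\mathcal{C}(X)\}\subseteq\mathcal{C}(E_f)$, and let $A(E_f/X)$ be the group of homeomorphisms $\Phi$ of $E_f$ with $q\circ\Phi=q$. Then $$\mathcal{C}(E_f)=q^*\mathcal{C}(X)[\alpha_1,\dots,\alpha_n],$$ and $\Phi\mapsto(\Phi^{-1})^*$, where $(\Phi^{-1})^*\beta=\beta\circ\Phi^{-1}$, is a group isomorphism $$A(E_f/X)\;\cong\;\mathrm{Aut}_{q^*\mathcal{C}(X)}\,\mathcal{C}(E_f)$$ onto the group of ring automorphisms of $\mathcal{C}(E_f)$ that fix $q^*\mathcal{C}(X)$ pointwise. -/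

import Mathlib

open Polynomial Topology

universe u

namespace SemiTopGalois

/-- Every point `x` has a neighbourhood `U` such that each loop in `U` based at `x` is
null-homotopic (rel endpoints) in the whole space. -/
def SemilocallySimplyConnected (X : Type u) [TopologicalSpace X] : Prop :=
  ∀ x : X, ∃ U ∈ 𝓝 x, ∀ γ : Path x x, Set.range γ ⊆ U → γ.Homotopic (Path.refl x)

/-- The complex polynomial `f_x(z)` obtained from `f ∈ C(X)[z]` by evaluating the coefficients
at the point `x`. -/
noncomputable def fiberPoly {X : Type u} [TopologicalSpace X] (f : C(X, ℂ)[X]) (x : X) : ℂ[X] :=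
  f.map (ContinuousMap.evalAlgHom ℂ ℂ x).toRingHom

/-- `f` is a Weierstrass polynomial of degree `n` on `X`: it is monic of degree `n`, and each
`f_x` has `n` distinct complex roots. -/
structure IsWeierstrass {X : Type u} [TopologicalSpace X] (f : C(X, ℂ)[X]) (n : ℕ) : Prop where
  monic : f.Monic
  natDegree_eq : f.natDegree = n
  ncard_roots : ∀ x : X, {z : ℂ | (fiberPoly f x).eval z = 0}.ncard = n

/-- A continuous function `α` on `X` is a root of `f` when `f_x(α(x)) = 0` for all `x`. -/
def IsRootFunction {X : Type u} [TopologicalSpace X] (f : C(X, ℂ)[X]) (α : C(X, ℂ)) : Prop :=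
  ∀ x : X, (fiberPoly f x).eval (α x) = 0

/-- `f`, of degree `n`, splits in `X`: it has `n` distinct continuous roots on `X`. -/
def SplitsOn {X : Type u} [TopologicalSpace X] (f : C(X, ℂ)[X]) (n : ℕ) : Prop :=
  ∃ α : Fin n → C(X, ℂ), Function.Injective α ∧ ∀ i, IsRootFunction f (α i)

/-- The pullback `q^* : C(X) → C(Y)`, `γ ↦ γ ∘ q`. -/
noncomputable def pullback {X Y : Type u} [TopologicalSpace X] [TopologicalSpace Y]
    (q : C(Y, X)) : C(X, ℂ) →+* C(Y, ℂ) :=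
  (ContinuousMap.compRightAlgHom ℂ ℂ q).toRingHom

/-- The pullback `q^* : C(X)[z] → C(Y)[z]`, applied to the coefficients. -/
noncomputable def pullbackPoly {X Y : Type u} [TopologicalSpace X] [TopologicalSpace Y]
    (q : C(Y, X)) (f : C(X, ℂ)[X]) : C(Y, ℂ)[X] :=
  f.map (pullback q)

/-- The subring `q^* C(X)` of `C(Y)`. -/
noncomputable def pullbackRing {X Y : Type u} [TopologicalSpace X] [TopologicalSpace Y]
    (q : C(Y, X)) : Subring C(Y, ℂ) :=
  (pullback q).range

/-- The covering `q : E → X`, with `E` path-connected, is a splitting covering of `f` (of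
degree `n`): `f` splits in `E`, and every path-connected covering `p : Y → X` in which `f`
splits factors through `q` by a covering map `Y → E`. -/
structure IsSplittingCovering {X E : Type u} [TopologicalSpace X] [TopologicalSpace E]
    (f : C(X, ℂ)[X]) (n : ℕ) (q : C(E, X)) : Prop where
  pathConnected : PathConnectedSpace E
  isCoveringMap : IsCoveringMap q
  splits : SplitsOn (pullbackPoly q f) n
  minimal : ∀ (Y : Type u) [TopologicalSpace Y] [PathConnectedSpace Y] (p : C(Y, X)),
    IsCoveringMap p → SplitsOn (pullbackPoly p f) n →
      ∃ π : C(Y, E), IsCoveringMap π ∧ q.comp π = p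

/-- The group `A(Y/X)` of covering transformations: homeomorphisms `Φ` of `Y` with `q ∘ Φ = q`,
under composition. -/
def coveringTransformations {X Y : Type u} [TopologicalSpace X] [TopologicalSpace Y]
    (q : C(Y, X)) : Subgroup (Y ≃ₜ Y) where
  carrier := {Φ | ∀ y, q (Φ y) = q y}
  one_mem' := fun _ => rfl
  mul_mem' := fun {Φ Ψ} hΦ hΨ y => (hΦ (Ψ y)).trans (hΨ y)
  inv_mem' := fun {Φ} hΦ y => by
    have h := hΦ (Φ.symm y)
    rw [Homeomorph.apply_symm_apply] at h
    exact h.symm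

end SemiTopGalois

namespace SemiTopGalois

/-! ### Continuous roots of a Weierstrass polynomial -/

section Roots

variable {X : Type u} [TopologicalSpace X] {f : C(X, ℂ)[X]} {n : ℕ}

/-! The roots of `f` are simple, so a continuous root over a connected space is determined by one
value (`root_eq_of_apply_eq`), and `n` distinct roots list all of them.

Identify points of `E` in the same fibre at which all `α i` agree. The quotient is still a covering
in which `f` splits, so minimality maps it onto `E`; comparing roots shows that the identification
was trivial (`eq_of_apply_eq`). Thus the roots separate the points of each fibre. It follows that
the covering is regular with finite group `A`, and that the `A`-invariant functions are exactly
those from the base.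

Generation is then Galois descent: `β` times the product of all `α i - α j` with `i ≠ j`, a unit
from the base, is a sum over `A` that expands into traces times polynomials in the roots.

For an automorphism `θ` and a point `e`, a norm argument realises the values `θ (α i) e` as the root
values at some `e'` over the same base point (`exists_apply_eq_algEquiv`). The transformation taking
`e` to `e'` induces a map that agrees with `θ` on every root, hence on the whole ring. -/

theorem fiberPoly_pullbackPoly {Y : Type u} [TopologicalSpace Y] (g : C(Y, X)) (f : C(X, ℂ)[X])
    (y : Y) : fiberPoly (pullbackPoly g f) y = fiberPoly f (g y) := by
  rw [fiberPoly, pullbackPoly, fiberPoly, Polynomial.map_map]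
  rfl

theorem isRootFunction_pullbackPoly {Y : Type u} [TopologicalSpace Y] {g : C(Y, X)}
    {a : C(Y, ℂ)} :
    IsRootFunction (pullbackPoly g f) a ↔ ∀ y, (fiberPoly f (g y)).eval (a y) = 0 := by
  simp only [IsRootFunction, fiberPoly_pullbackPoly]

/-- Here `A` may live in any universe, unlike in `pullbackPoly`, so that roots can be compared along
`unitInterval`. -/
theorem eval_map_compRight {A : Type*} [TopologicalSpace A] (g : C(A, X)) (f : C(X, ℂ)[X])
    (a : C(A, ℂ)) (t : A) :
    (f.map (ContinuousMap.compRightAlgHom ℂ ℂ g).toRingHom).eval a t =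
      (fiberPoly f (g t)).eval (a t) := by
  have h := Polynomial.hom_eval₂ f (ContinuousMap.compRightAlgHom ℂ ℂ g).toRingHom
    (ContinuousMap.evalAlgHom ℂ ℂ t).toRingHom a
  rw [Polynomial.eval_map, fiberPoly, Polynomial.eval_map]
  exact h

theorem isRootFunction_pullbackPoly_iff_eval {Y : Type u} [TopologicalSpace Y] {g : C(Y, X)}
    {a : C(Y, ℂ)} :
    IsRootFunction (pullbackPoly g f) a ↔ (pullbackPoly g f).eval a = 0 := by
  rw [isRootFunction_pullbackPoly, ContinuousMap.ext_iff]
  refine forall_congr' fun y => ?_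
  rw [← eval_map_compRight]
  rfl

theorem IsWeierstrass.fiberPoly_monic (hf : IsWeierstrass f n) (x : X) :
    (fiberPoly f x).Monic :=
  hf.monic.map _

theorem IsWeierstrass.natDegree_fiberPoly (hf : IsWeierstrass f n) (x : X) :
    (fiberPoly f x).natDegree = n := by
  rw [fiberPoly, hf.monic.natDegree_map, hf.natDegree_eq]

theorem IsWeierstrass.finite_roots (hf : IsWeierstrass f n) (x : X) :
    {z : ℂ | (fiberPoly f x).eval z = 0}.Finite :=
  Polynomial.finite_setOfPred_isRoot (hf.fiberPoly_monic x).ne_zero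

/-- Having `n` distinct roots in degree `n` leaves no room for a multiple root. -/
theorem IsWeierstrass.eval_derivative_ne_zero (hf : IsWeierstrass f n) {x : X} {z : ℂ}
    (hz : (fiberPoly f x).eval z = 0) : (derivative (fiberPoly f x)).eval z ≠ 0 := by
  have hne := (hf.fiberPoly_monic x).ne_zero
  have hroots : {z : ℂ | (fiberPoly f x).eval z = 0} = (fiberPoly f x).roots.toFinset := by
    ext w
    simp [hne]
  have hcard := hf.ncard_roots x
  rw [hroots, Set.ncard_coe_finset] at hcard
  have hle : Multiset.card (fiberPoly f x).roots ≤ n :=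
    (Polynomial.card_roots' _).trans (hf.natDegree_fiberPoly x).le
  have hnodup : (fiberPoly f x).roots.Nodup := by
    rw [← Multiset.toFinset_card_eq_card_iff_nodup]
    exact le_antisymm (Multiset.toFinset_card_le _) (hle.trans hcard.ge)
  exact ((Polynomial.nodup_roots_iff_of_splits hne (IsAlgClosed.splits _)).1
    hnodup).eval₂_derivative_ne_zero (RingHom.id ℂ) (by simpa using hz)

/-- Two continuous roots over a preconnected space which agree at one point are equal. -/
theorem IsWeierstrass.root_eq_of_apply_eq {A : Type*} [TopologicalSpace A] [PreconnectedSpace A]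
    (hf : IsWeierstrass f n) (g : C(A, X)) {a b : C(A, ℂ)}
    (ha : ∀ t, (fiberPoly f (g t)).eval (a t) = 0)
    (hb : ∀ t, (fiberPoly f (g t)).eval (b t) = 0) {t₀ : A} (h : a t₀ = b t₀) : a = b := by
  set F := f.map (ContinuousMap.compRightAlgHom ℂ ℂ g).toRingHom with hF
  -- Taylor expansion at `b`: `F(a) = F(b) + F'(b)(a - b) + k(a - b)²`. As `F(a) = F(b) = 0`, at
  -- each point either `a = b` or the cofactor of `a - b` vanishes, never both since `F'(b) ≠ 0`. So
  -- the closed set where `a = b` is also open.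
  obtain ⟨k, hk⟩ := F.binomExpansion b (a - b)
  have hzero : ∀ t, (a t - b t) * (F.derivative.eval b t + k t * (a t - b t)) = 0 := fun t => by
    have := congrArg (fun c : C(A, ℂ) => c t) hk
    simp only [add_sub_cancel, ContinuousMap.add_apply, ContinuousMap.mul_apply,
      ContinuousMap.pow_apply, ContinuousMap.sub_apply] at this
    rw [hF, eval_map_compRight, eval_map_compRight, ha, hb, ← hF] at this
    linear_combination -this
  have hderiv : ∀ t, F.derivative.eval b t ≠ 0 := fun t => by
    rw [hF, Polynomial.derivative_map, eval_map_compRight, fiberPoly, ← Polynomial.derivative_map]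
    exact hf.eval_derivative_ne_zero (hb t)
  have hset : {t | a t = b t} = {t | F.derivative.eval b t + k t * (a t - b t) ≠ 0} := by
    ext t
    constructor
    · intro hab
      have hab : a t = b t := hab
      simpa [hab] using hderiv t
    · intro hne
      exact sub_eq_zero.1 ((mul_eq_zero.1 (hzero t)).resolve_right hne)
  have hclopen : IsClopen {t | a t = b t} :=
    ⟨isClosed_eq a.continuous b.continuous, hset ▸ isOpen_ne_fun (by fun_prop) (by fun_prop)⟩
  ext t
  exact Set.eq_univ_iff_forall.1 (hclopen.eq_univ ⟨t₀, h⟩) t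

variable {Y : Type u} [TopologicalSpace Y] [PreconnectedSpace Y] {g : C(Y, X)}
  {α : Fin n → C(Y, ℂ)}

/-- Distinct continuous roots on a preconnected space take distinct values at each point. -/
theorem IsWeierstrass.injective_apply (hf : IsWeierstrass f n) (hα_inj : Function.Injective α)
    (hα : ∀ i, IsRootFunction (pullbackPoly g f) (α i)) (y : Y) :
    Function.Injective fun i => α i y := fun i j hij =>
  hα_inj (hf.root_eq_of_apply_eq g (isRootFunction_pullbackPoly.1 (hα i))
    (isRootFunction_pullbackPoly.1 (hα j)) hij)

/-- Each root of `f_x` is the value of one of `n` distinct continuous roots. -/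
theorem IsWeierstrass.exists_apply_eq (hf : IsWeierstrass f n) (hα_inj : Function.Injective α)
    (hα : ∀ i, IsRootFunction (pullbackPoly g f) (α i)) {y : Y} {z : ℂ}
    (hz : (fiberPoly f (g y)).eval z = 0) : ∃ i, α i y = z := by
  have hsub : Set.range (fun i => α i y) ⊆ {z : ℂ | (fiberPoly f (g y)).eval z = 0} := by
    rintro _ ⟨i, rfl⟩
    exact isRootFunction_pullbackPoly.1 (hα i) y
  have heq := Set.eq_of_subset_of_ncard_le hsub
    (by rw [hf.ncard_roots, Set.ncard_range_of_injective (hf.injective_apply hα_inj hα y)]; simp)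
    (hf.finite_roots _)
  exact heq.ge hz

/-- Each continuous root on a nonempty preconnected space is one of `n` given distinct ones. -/
theorem IsWeierstrass.exists_eq_of_isRootFunction [Nonempty Y] (hf : IsWeierstrass f n)
    (hα_inj : Function.Injective α) (hα : ∀ i, IsRootFunction (pullbackPoly g f) (α i))
    {b : C(Y, ℂ)} (hb : IsRootFunction (pullbackPoly g f) b) : ∃ i, α i = b := by
  obtain ⟨y⟩ := ‹Nonempty Y›
  obtain ⟨i, hi⟩ := hf.exists_apply_eq hα_inj hα (isRootFunction_pullbackPoly.1 hb y)
  exact ⟨i, hf.root_eq_of_apply_eq g (isRootFunction_pullbackPoly.1 (hα i))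
    (isRootFunction_pullbackPoly.1 hb) hi⟩

end Roots

/-! ### Surjectivity, local path-connectedness and quotients of coverings -/

section Coverings

variable {X E : Type*} [TopologicalSpace X] [TopologicalSpace E] {q : E → X}

/-- A covering map from a nonempty space to a path-connected space is surjective. -/
theorem surjective_of_isCoveringMap [Nonempty E] [PathConnectedSpace X] (hq : IsCoveringMap q) :
    Function.Surjective q := fun x => by
  obtain ⟨e⟩ := ‹Nonempty E›
  let γ := PathConnectedSpace.somePath (q e) x
  obtain ⟨Γ, hΓ, -⟩ := hq.exists_path_lifts γ.toContinuousMap e γ.source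
  exact ⟨Γ 1, (congrFun hΓ 1).trans γ.target⟩

/-- The total space of a covering of a locally path-connected space is locally path-connected. -/
theorem locallyPathConnectedSpace_of_isLocalHomeomorph [LocallyPathConnectedSpace X]
    (hq : IsLocalHomeomorph q) : LocallyPathConnectedSpace E := by
  rw [locallyPathConnectedSpace_iff_pathComponentIn_mem_nhds]
  intro e u hu heu
  obtain ⟨φ, heφ, -⟩ := hq e
  have hopen : IsOpen (φ '' (φ.source ∩ u)) := φ.isOpen_image_source_inter hu
  obtain ⟨W, ⟨hW, hWconn⟩, hWsub⟩ := (path_connected_basis (φ e)).mem_iff.1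
    (hopen.mem_nhds ⟨e, ⟨heφ, heu⟩, rfl⟩)
  have hWt : W ⊆ φ.target := fun w hw => by
    obtain ⟨e', he', rfl⟩ := hWsub hw
    exact φ.map_source he'.1
  have hpath : IsPathConnected (φ.symm '' W) :=
    hWconn.image' (φ.continuousOn_symm.mono hWt)
  have hsub : φ.symm '' W ⊆ u := by
    rintro _ ⟨w, hw, rfl⟩
    obtain ⟨e', he', rfl⟩ := hWsub hw
    rw [φ.left_inv he'.1]
    exact he'.2
  refine Filter.mem_of_superset ?_
    (hpath.subset_pathComponentIn ⟨φ e, mem_of_mem_nhds hW, φ.left_inv heφ⟩ hsub)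
  have h := φ.symm.image_mem_nhds (φ.map_source heφ) hW
  rwa [φ.left_inv heφ] at h

/-- The quotient of a covering of a locally connected space by an equivalence relation on the
fibres which is invariant under continuation of sections over connected open sets is a covering. -/
theorem isCoveringMap_quotient_lift [LocallyConnectedSpace X] (hq : IsCoveringMap q)
    (hsurj : Function.Surjective q) (r : Setoid E) (hr : ∀ e e', r e e' → q e = q e')
    (hcont : ∀ (U : Set X), IsPreconnected U → ∀ s s' : X → E, ContinuousOn s U →
      ContinuousOn s' U → (∀ x ∈ U, q (s x) = x) → (∀ x ∈ U, q (s' x) = x) →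
      ∀ x ∈ U, r (s x) (s' x) → ∀ x' ∈ U, r (s x') (s' x')) :
    IsCoveringMap (Quotient.lift q hr) := by
  intro x
  have : Nonempty (q ⁻¹' {x}) := let ⟨e, he⟩ := hsurj x; ⟨⟨e, he⟩⟩
  have := (hq x).discreteTopology_fiber
  set t := (hq x).toTrivialization
  have hxt : x ∈ t.baseSet := (hq x).mem_toTrivialization_baseSet
  obtain ⟨U, ⟨hUo, hxU, hUc⟩, hUt⟩ :=
    (LocallyConnectedSpace.open_connected_basis x).mem_iff.1 (t.open_baseSet.mem_nhds hxt)
  simp only [id] at hUt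
  let sec (i : q ⁻¹' {x}) (x' : X) : E := t.toOpenPartialHomeomorph.symm (x', i)
  have hsec_cont i : ContinuousOn (sec i) U :=
    t.toOpenPartialHomeomorph.continuousOn_symm.comp (by fun_prop)
      fun y hy => t.mem_target.2 (hUt hy)
  have hsec_q i : ∀ y ∈ U, q (sec i y) = y := fun y hy =>
    t.proj_symm_apply (t.mem_target.2 (hUt hy))
  have hsec_snd i : ∀ y ∈ U, (t (sec i y)).2 = i := fun y hy => by
    have := t.apply_symm_apply (t.mem_target.2 (hUt hy) : (y, i) ∈ t.target)
    exact congrArg Prod.snd this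
  have hsec_self : ∀ e, q e ∈ U → sec (t e).2 (q e) = e := fun e he =>
    t.symm_apply_mk_proj (t.mem_source.2 (hUt he))
  have htransport i j : ∀ y ∈ U, r (sec i y) (sec j y) → ∀ y' ∈ U, r (sec i y') (sec j y') :=
    hcont U hUc.isPreconnected _ _ (hsec_cont i) (hsec_cont j) (hsec_q i) (hsec_q j)
  -- By continuation over the connected set `U`, two sheets are identified at every point of `U` or
  -- at none. Hence classes of sheets, read off over `x`, index the sheets `V c` of the quotient.
  let ri : Setoid (q ⁻¹' {x}) := r.comap fun i => sec i x
  have hri : ∀ e e', q e ∈ U → r e e' →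
      (Quotient.mk ri (t e).2) = Quotient.mk ri (t e').2 := fun e e' he hee' => by
    have hqe := hr _ _ hee'
    refine Quotient.sound (htransport _ _ (q e) he ?_ x hxU)
    rwa [hsec_self e he, hqe, hsec_self e' (hqe ▸ he)]
  let V (c : Quotient ri) : Set (Quotient r) :=
    {a | ∃ e, q e ∈ U ∧ Quotient.mk ri (t e).2 = c ∧ Quotient.mk r e = a}
  have hV : ∀ c e, Quotient.mk r e ∈ V c → Quotient.mk ri (t e).2 = c := by
    rintro c e ⟨e', he', rfl, hee'⟩
    exact (hri e' e he' (Quotient.exact hee')).symm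
  have hmk : ∀ i, ∀ y ∈ U, Quotient.mk r (sec i y) ∈ V (Quotient.mk ri i) := fun i y hy =>
    ⟨sec i y, by rwa [hsec_q i y hy], by rw [hsec_snd i y hy], rfl⟩
  have : Nonempty (Quotient ri) := (‹Nonempty (q ⁻¹' {x})›).map (Quotient.mk ri)
  have : Nonempty (X → Quotient r) := ⟨fun _ => Quotient.mk r (sec (Classical.arbitrary _) x)⟩
  let _ : TopologicalSpace (Quotient ri) := ⊥
  have : DiscreteTopology (Quotient ri) := ⟨rfl⟩
  refine IsEvenlyCovered.to_isEvenlyCovered_preimage (I := Quotient ri)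
    (.of_trivialization (t := hUo.trivializationDiscrete V U
      (fun c W hW => ⟨fun h => ?_, fun h => ?_⟩) (fun c => ?_) (fun c => ?_) (fun c d hcd => ?_) ?_) hxU)
  · rw [← isQuotientMap_quotient_mk'.isOpen_preimage]
    have hset : Quotient.mk r ⁻¹' (Quotient.lift q hr ⁻¹' W ∩ V c) =
        t.source ∩ t ⁻¹' (W ×ˢ (Quotient.mk ri ⁻¹' {c})) := by
      ext e
      constructor
      · rintro ⟨heW, heV⟩
        have heW : q e ∈ W := heW
        have hes : e ∈ t.source := t.mem_source.2 (hUt (hW heW))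
        exact ⟨hes, by rwa [t.coe_fst hes], hV c e heV⟩
      · rintro ⟨hes, heW, heV⟩
        rw [t.coe_fst hes] at heW
        exact ⟨heW, e, hW heW, heV, rfl⟩
    exact hset ▸ t.continuousOn_toFun.isOpen_inter_preimage t.open_source
      (h.prod (isOpen_discrete _))
  · induction c using Quotient.inductionOn with | _ i
    rw [← isQuotientMap_quotient_mk'.isOpen_preimage] at h
    have hset : W = U ∩ sec i ⁻¹' (Quotient.mk r ⁻¹'
        (Quotient.lift q hr ⁻¹' W ∩ V (Quotient.mk ri i))) := by
      ext y
      constructor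
      · intro hy
        refine ⟨hW hy, ?_, hmk i y (hW hy)⟩
        show q (sec i y) ∈ W
        rwa [hsec_q i y (hW hy)]
      · rintro ⟨hy, hyW, -⟩
        have hyW : q (sec i y) ∈ W := hyW
        rwa [hsec_q i y hy] at hyW
    rw [hset]
    exact (hsec_cont i).isOpen_inter_preimage hUo h
  · rintro _ ⟨e, he, rfl, rfl⟩ _ ⟨e', he', hee', rfl⟩ hq'
    have hq' : q e = q e' := hq'
    have hrx : ri (t e').2 (t e).2 := Quotient.exact hee'
    have := htransport _ _ x hxU hrx (q e) he
    rw [hsec_self e he, hq', hsec_self e' he'] at this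
    exact Quotient.sound (r.symm this)
  · induction c using Quotient.inductionOn with | _ i
    exact fun y hy => ⟨_, hmk i y hy, hsec_q i y hy⟩
  · refine Set.disjoint_left.2 ?_
    rintro a hac hbd
    induction a using Quotient.inductionOn with | _ e
    exact hcd ((hV c e hac).symm.trans (hV d e hbd))
  · intro a ha
    induction a using Quotient.inductionOn with | _ e
    exact Set.mem_iUnion.2 ⟨_, e, ha, rfl, rfl⟩

end Coverings

/-! ### Separation of fibres by the roots, and regularity -/

section SplittingCovering

variable {X E : Type u} [TopologicalSpace X] [TopologicalSpace E] {f : C(X, ℂ)[X]} {n : ℕ}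
  {q : C(E, X)} {α : Fin n → C(E, ℂ)}

/-- The relation on `E` of lying in the same fibre and having the same values of all `α i`. -/
noncomputable def rootSetoid (q : C(E, X)) (α : Fin n → C(E, ℂ)) : Setoid E :=
  Setoid.ker fun e => (q e, fun i => α i e)

theorem rootSetoid_iff {e e' : E} :
    rootSetoid q α e e' ↔ q e = q e' ∧ ∀ i, α i e = α i e' :=
  Prod.mk_inj.trans (and_congr_right fun _ => funext_iff)

/-- Composing `α i` with two local sections over a connected set gives two roots of `f` there; if
they agree at one point, they agree throughout. -/
theorem isCoveringMap_rootSetoid_lift [PathConnectedSpace X] [LocallyPathConnectedSpace X]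
    [PathConnectedSpace E] (hf : IsWeierstrass f n) (hq : IsCoveringMap q)
    (hα : ∀ i, IsRootFunction (pullbackPoly q f) (α i)) :
    IsCoveringMap (Quotient.lift q fun _ _ h => (rootSetoid_iff (α := α).1 h).1) := by
  refine isCoveringMap_quotient_lift hq (surjective_of_isCoveringMap hq) _ _
    fun U hU s s' hs hs' hqs hqs' x hx hxx' x' hx' => rootSetoid_iff.2
      ⟨(hqs x' hx').trans (hqs' x' hx').symm, fun i => ?_⟩
  have : PreconnectedSpace U := isPreconnected_iff_preconnectedSpace.1 hU
  rw [continuousOn_iff_continuous_domRestrict] at hs hs'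
  have h := hf.root_eq_of_apply_eq (A := U) ⟨Subtype.val, continuous_subtype_val⟩
    (a := (α i).comp ⟨_, hs⟩) (b := (α i).comp ⟨_, hs'⟩)
    (fun t => by
      have := isRootFunction_pullbackPoly.1 (hα i) (s t)
      rwa [hqs t t.2] at this)
    (fun t => by
      have := isRootFunction_pullbackPoly.1 (hα i) (s' t)
      rwa [hqs' t t.2] at this)
    (t₀ := ⟨x, hx⟩) ((rootSetoid_iff.1 hxx').2 i)
  exact congrArg (fun c : C(U, ℂ) => c ⟨x', hx'⟩) h

/-- In a splitting covering, the roots separate the points of each fibre. -/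
theorem IsSplittingCovering.eq_of_apply_eq [PathConnectedSpace X] [LocallyPathConnectedSpace X]
    (hf : IsWeierstrass f n) (hq : IsSplittingCovering f n q) (hα_inj : Function.Injective α)
    (hα : ∀ i, IsRootFunction (pullbackPoly q f) (α i)) {e e' : E} (hqe : q e = q e')
    (h : ∀ i, α i e = α i e') : e = e' := by
  have := hq.pathConnected
  let p : C(Quotient (rootSetoid q α), X) :=
    ⟨Quotient.lift q fun _ _ h => (rootSetoid_iff (α := α).1 h).1, q.continuous.quotient_lift _⟩
  let a (i : Fin n) : C(Quotient (rootSetoid q α), ℂ) :=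
    ⟨Quotient.lift (α i) fun _ _ h => (rootSetoid_iff.1 h).2 i, (α i).continuous.quotient_lift _⟩
  have ha_inj : Function.Injective a := fun i j hij => hα_inj <| by
    ext y
    exact congrArg (fun c : C(Quotient (rootSetoid q α), ℂ) => c (Quotient.mk _ y)) hij
  have ha : ∀ i, IsRootFunction (pullbackPoly p f) (a i) := fun i =>
    isRootFunction_pullbackPoly.2 fun y => by
      induction y using Quotient.inductionOn with | _ y
      exact isRootFunction_pullbackPoly.1 (hα i) y
  obtain ⟨π, hπ, hqπ⟩ := hq.minimal _ p (isCoveringMap_rootSetoid_lift hf hq.isCoveringMap hα)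
    ⟨a, ha_inj, ha⟩
  have hqπ : ∀ y, q (π y) = p y := fun y => congrArg (fun c : C(_, X) => c y) hqπ
  have hb_inj : Function.Injective fun i => (α i).comp π := fun i j hij => hα_inj <| by
    ext y
    obtain ⟨y, rfl⟩ := surjective_of_isCoveringMap hπ y
    exact congrArg (fun c : C(_, ℂ) => c y) hij
  have hb : ∀ i, IsRootFunction (pullbackPoly p f) ((α i).comp π) := fun i =>
    isRootFunction_pullbackPoly.2 fun y => by
      have := isRootFunction_pullbackPoly.1 (hα i) (π y)
      rwa [hqπ] at this
  obtain ⟨y, rfl⟩ := surjective_of_isCoveringMap hπ e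
  obtain ⟨y', rfl⟩ := surjective_of_isCoveringMap hπ e'
  rw [hqπ, hqπ] at hqe
  congr 1
  -- The functions `α j ∘ π` already exhaust the roots on the quotient, so each `a i` is one of them
  -- and cannot tell `y` from `y'`.
  have hay : ∀ i, a i y = a i y' := fun i => by
    obtain ⟨j, hj⟩ := hf.exists_eq_of_isRootFunction hb_inj hb (ha i)
    rw [← hj]
    exact h j
  clear h
  induction y using Quotient.inductionOn with | _ y
  induction y' using Quotient.inductionOn with | _ y'
  exact Quotient.sound (rootSetoid_iff.2 ⟨hqe, hay⟩)

/-- A splitting covering is regular: covering transformations act transitively on fibres. -/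
theorem IsSplittingCovering.exists_lift [PathConnectedSpace X] [LocallyPathConnectedSpace X]
    (hf : IsWeierstrass f n) (hq : IsSplittingCovering f n q) (hα_inj : Function.Injective α)
    (hα : ∀ i, IsRootFunction (pullbackPoly q f) (α i)) {e e' : E} (hqe : q e = q e') :
    ∃ Φ : C(E, E), Φ e = e' ∧ ∀ y, q (Φ y) = q y := by
  have := hq.pathConnected
  have := locallyPathConnectedSpace_of_isLocalHomeomorph hq.isCoveringMap.isLocalHomeomorph
  have hroot i : ∃ j, α j e = α i e' := hf.exists_apply_eq hα_inj hα <| by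
    rw [hqe]
    exact isRootFunction_pullbackPoly.1 (hα i) e'
  choose σ hσ using hroot
  -- The matching `σ` of root values at `e'` with those at `e` persists along paths. The root values
  -- at the end of `Γ` thus depend only on the endpoint of `γ`; by separation so does `Γ 1`, which
  -- is what the lifting criterion requires.
  have key (γ Γ : C(unitInterval, E)) (h0 : γ 0 = e) (h0' : Γ 0 = e') (hlift : q ∘ Γ = q.comp γ)
      (i : Fin n) : α i (Γ 1) = α (σ i) (γ 1) := by
    have h := hf.root_eq_of_apply_eq (q.comp γ) (a := (α i).comp Γ) (b := (α (σ i)).comp γ)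
      (fun t => by
        have := isRootFunction_pullbackPoly.1 (hα i) (Γ t)
        rwa [show q (Γ t) = q.comp γ t from congrFun hlift t] at this)
      (fun t => isRootFunction_pullbackPoly.1 (hα (σ i)) (γ t)) (t₀ := 0)
      (by simp [h0, h0', hσ])
    exact congrArg (fun c : C(unitInterval, ℂ) => c 1) h
  obtain ⟨Φ, ⟨hΦe, hΦq⟩, -⟩ :=
    hq.isCoveringMap.isLocalHomeomorph.existsUnique_continuousMap_lifts q e e' hqe.symm
      (fun γ hγ => by
        obtain ⟨Γ, h, h0⟩ := hq.isCoveringMap.exists_path_lifts (q.comp γ) e' (by simp [hγ, hqe])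
        exact ⟨Γ, h0, h⟩)
      (fun γ γ' Γ Γ' h0 h0' hΓ hΓ' hl hl' h1 => by
        refine hq.eq_of_apply_eq hf hα_inj hα ?_ fun i => ?_
        · have h := congrFun hl 1
          have h' := congrFun hl' 1
          simp only [Function.comp_apply, ContinuousMap.comp_apply] at h h'
          rw [h, h', h1]
        · rw [key γ Γ h0 hΓ hl, key γ' Γ' h0' hΓ' hl', h1])
  exact ⟨Φ, hΦe, congrFun hΦq⟩

/-- The lifts taking `e` to `e'` and `e'` to `e` are mutually inverse by uniqueness of lifts. -/
theorem IsSplittingCovering.exists_coveringTransformation [PathConnectedSpace X]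
    [LocallyPathConnectedSpace X] (hf : IsWeierstrass f n) (hq : IsSplittingCovering f n q)
    {e e' : E} (hqe : q e = q e') : ∃ Φ : coveringTransformations q, (Φ : E ≃ₜ E) e = e' := by
  have := hq.pathConnected
  obtain ⟨α, hα_inj, hα⟩ := hq.splits
  obtain ⟨Φ, hΦe, hΦ⟩ := hq.exists_lift hf hα_inj hα hqe
  obtain ⟨Ψ, hΨe, hΨ⟩ := hq.exists_lift hf hα_inj hα hqe.symm
  have h₁ : Ψ ∘ Φ = id := hq.isCoveringMap.eq_of_comp_eq (by fun_prop) continuous_id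
    (by ext y; simp [hΨ, hΦ]) e (by simp [hΦe, hΨe])
  have h₂ : Φ ∘ Ψ = id := hq.isCoveringMap.eq_of_comp_eq (by fun_prop) continuous_id
    (by ext y; simp [hΨ, hΦ]) e' (by simp [hΦe, hΨe])
  exact ⟨⟨⟨⟨Φ, Ψ, congrFun h₁, congrFun h₂⟩, Φ.continuous, Ψ.continuous⟩, hΦ⟩, hΦe⟩

/-- A continuous function which is constant on the fibres of a covering descends to the base. -/
theorem mem_pullbackRing_of_const_on_fibers [Nonempty E] [PathConnectedSpace X]
    (hq : IsCoveringMap q) {b : C(E, ℂ)} (hb : ∀ e e', q e = q e' → b e = b e') :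
    b ∈ pullbackRing q := by
  have hquot := hq.isQuotientMap (surjective_of_isCoveringMap hq)
  refine ⟨hquot.lift b fun e e' h => hb e e' h, ?_⟩
  ext y
  exact congrArg (fun c : C(E, ℂ) => c y) (hquot.lift_comp b _)

theorem apply_eq_of_mem_pullbackRing {b : C(E, ℂ)} (hb : b ∈ pullbackRing q) {e e' : E}
    (h : q e = q e') : b e = b e' := by
  obtain ⟨c, rfl⟩ := hb
  exact congrArg c h

end SplittingCovering

/-! ### The Galois correspondence between transformations and automorphisms -/

section Galois

variable {X E : Type u} [TopologicalSpace X] [TopologicalSpace E] {f : C(X, ℂ)[X]} {n : ℕ}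
  {q : C(E, X)} {α : Fin n → C(E, ℂ)}

/-- The function `β ∘ Φ`, for a covering transformation `Φ`. -/
noncomputable def transl (Φ : coveringTransformations q) (β : C(E, ℂ)) : C(E, ℂ) :=
  β.comp ⟨(Φ : E ≃ₜ E), (Φ : E ≃ₜ E).continuous⟩

@[simp]
theorem transl_apply (Φ : coveringTransformations q) (β : C(E, ℂ)) (y : E) :
    transl Φ β y = β ((Φ : E ≃ₜ E) y) := rfl

theorem isRootFunction_transl (Φ : coveringTransformations q) {β : C(E, ℂ)}
    (hβ : IsRootFunction (pullbackPoly q f) β) : IsRootFunction (pullbackPoly q f) (transl Φ β) :=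
  isRootFunction_pullbackPoly.2 fun y => by
    have := isRootFunction_pullbackPoly.1 hβ ((Φ : E ≃ₜ E) y)
    rwa [Φ.2 y] at this

/-- The action of covering transformations on functions, `Φ ↦ (Φ⁻¹)^*`. -/
noncomputable def coveringTransformationsToAut (q : C(E, X)) :
    coveringTransformations q →* (C(E, ℂ) ≃ₐ[pullbackRing q] C(E, ℂ)) where
  toFun Φ :=
    { toFun := transl Φ⁻¹
      invFun := transl Φ
      left_inv := fun β => by
        ext y
        exact congrArg β ((Φ : E ≃ₜ E).symm_apply_apply y)
      right_inv := fun β => by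
        ext y
        exact congrArg β ((Φ : E ≃ₜ E).apply_symm_apply y)
      map_mul' := fun _ _ => rfl
      map_add' := fun _ _ => rfl
      commutes' := fun b => by
        ext y
        exact apply_eq_of_mem_pullbackRing b.2 (Φ⁻¹.2 y) }
  map_one' := rfl
  map_mul' Φ Ψ := rfl

theorem coveringTransformationsToAut_apply (Φ : coveringTransformations q) (β : C(E, ℂ)) (y : E) :
    coveringTransformationsToAut q Φ β y = β ((Φ : E ≃ₜ E).symm y) := rfl

theorem adjoin_mem_of_mem_pullbackRing {b : C(E, ℂ)} (hb : b ∈ pullbackRing q) (S : Set C(E, ℂ)) :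
    b ∈ Algebra.adjoin (pullbackRing q) S :=
  (Algebra.adjoin (pullbackRing q) S).algebraMap_mem ⟨b, hb⟩

variable [PathConnectedSpace X] [LocallyPathConnectedSpace X]

/-- A covering transformation which permutes the roots trivially is the identity. -/
theorem IsSplittingCovering.eq_of_transl_eq (hf : IsWeierstrass f n)
    (hq : IsSplittingCovering f n q) (hα_inj : Function.Injective α)
    (hα : ∀ i, IsRootFunction (pullbackPoly q f) (α i)) {Φ Ψ : coveringTransformations q}
    (h : ∀ i, transl Φ (α i) = transl Ψ (α i)) : Φ = Ψ :=
  Subtype.ext <| Homeomorph.ext fun y => hq.eq_of_apply_eq hf hα_inj hα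
    ((Φ.2 y).trans (Ψ.2 y).symm) fun i => congrArg (fun c : C(E, ℂ) => c y) (h i)

/-- A transformation is determined by how it permutes the `n` roots. -/
theorem IsSplittingCovering.finite_coveringTransformations (hf : IsWeierstrass f n)
    (hq : IsSplittingCovering f n q) : Finite (coveringTransformations q) := by
  have := hq.pathConnected
  obtain ⟨α, hα_inj, hα⟩ := hq.splits
  choose σ hσ using fun (Φ : coveringTransformations q) i =>
    hf.exists_eq_of_isRootFunction hα_inj hα (isRootFunction_transl Φ (hα i))
  exact Finite.of_injective σ fun Φ Ψ h => hq.eq_of_transl_eq hf hα_inj hα fun i => by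
    rw [← hσ, ← hσ, h]

/-- A function invariant under the covering transformations is a pullback from the base. -/
theorem IsSplittingCovering.mem_pullbackRing (hf : IsWeierstrass f n)
    (hq : IsSplittingCovering f n q) {β : C(E, ℂ)}
    (hβ : ∀ (Φ : coveringTransformations q) y, β ((Φ : E ≃ₜ E) y) = β y) :
    β ∈ pullbackRing q := by
  have := hq.pathConnected
  refine mem_pullbackRing_of_const_on_fibers hq.isCoveringMap fun e e' h => ?_
  obtain ⟨Φ, rfl⟩ := hq.exists_coveringTransformation hf h
  exact (hβ Φ e).symm

/-- In each factor `α p.1` does not depend on `Φ` and comes out of the sum, while `transl Φ (α p.2)`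
is absorbed into `β`; hence the induction must vary `β`. With no factors left, the sum is a trace,
which is invariant. -/
theorem IsSplittingCovering.sum_transl_mul_prod_mem_adjoin [Fintype (coveringTransformations q)]
    (hf : IsWeierstrass f n) (hq : IsSplittingCovering f n q) (α : Fin n → C(E, ℂ))
    (s : Finset (Fin n × Fin n)) (β : C(E, ℂ)) :
    ∑ Φ : coveringTransformations q, transl Φ β * ∏ p ∈ s, (α p.1 - transl Φ (α p.2)) ∈
      Algebra.adjoin (pullbackRing q) (Set.range α) := by
  induction s using Finset.cons_induction generalizing β with
  | empty =>
    refine adjoin_mem_of_mem_pullbackRing (hq.mem_pullbackRing hf fun Ψ y => ?_) _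
    simp only [Finset.prod_empty, mul_one, ContinuousMap.sum_apply, transl_apply]
    exact Fintype.sum_equiv (Equiv.mulRight Ψ) _ _ fun Φ => rfl
  | cons p s hp ih =>
    have : ∑ Φ : coveringTransformations q,
        transl Φ β * ∏ p ∈ Finset.cons p s hp, (α p.1 - transl Φ (α p.2)) =
        α p.1 * (∑ Φ : coveringTransformations q,
          transl Φ β * ∏ p ∈ s, (α p.1 - transl Φ (α p.2))) -
        ∑ Φ : coveringTransformations q,
          transl Φ (β * α p.2) * ∏ p ∈ s, (α p.1 - transl Φ (α p.2)) := by
      rw [Finset.mul_sum, ← Finset.sum_sub_distrib]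
      refine Finset.sum_congr rfl fun Φ _ => ?_
      rw [Finset.prod_cons, show transl Φ (β * α p.2) = transl Φ β * transl Φ (α p.2) from rfl]
      ring
    rw [this]
    exact sub_mem (mul_mem (Algebra.subset_adjoin ⟨p.1, rfl⟩) (ih β)) (ih _)

/-- The ring of functions on a splitting covering is generated by the roots. -/
theorem IsSplittingCovering.adjoin_range_eq_top (hf : IsWeierstrass f n)
    (hq : IsSplittingCovering f n q) (hα_inj : Function.Injective α)
    (hα : ∀ i, IsRootFunction (pullbackPoly q f) (α i)) :
    Algebra.adjoin (pullbackRing q) (Set.range α) = ⊤ := by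
  classical
  have := hq.pathConnected
  have := hq.finite_coveringTransformations hf
  have := Fintype.ofFinite (coveringTransformations q)
  let s : Finset (Fin n × Fin n) := Finset.univ.offDiag
  let D : C(E, ℂ) := ∏ p ∈ s, (α p.1 - α p.2)
  have hDapp y : D y = ∏ p ∈ s, (α p.1 y - α p.2 y) := by
    simp [D, ContinuousMap.prod_apply]
  have hD0 y : D y ≠ 0 := by
    rw [hDapp, Finset.prod_ne_zero_iff]
    intro p hp h
    exact (Finset.mem_offDiag.1 hp).2.2 (hf.injective_apply hα_inj hα y (sub_eq_zero.1 h))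
  choose σ hσ using fun (Φ : coveringTransformations q) i =>
    hf.exists_eq_of_isRootFunction hα_inj hα (isRootFunction_transl Φ (hα i))
  have hσapp (Φ : coveringTransformations q) i y : α i ((Φ : E ≃ₜ E) y) = α (σ Φ i) y :=
    congrArg (fun c : C(E, ℂ) => c y) (hσ Φ i).symm
  have hσinj Φ : Function.Injective (σ Φ) := fun i j hij => by
    have e : E := Classical.arbitrary E
    refine hf.injective_apply hα_inj hα ((Φ : E ≃ₜ E) e) ?_
    simp only [hσapp, hij]
  have hDinv (Φ : coveringTransformations q) y : D ((Φ : E ≃ₜ E) y) = D y := by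
    simp only [hDapp, hσapp]
    let τ : Equiv.Perm (Fin n) := Equiv.ofBijective (σ Φ) (hσinj Φ).bijective_of_finite
    exact Finset.prod_equiv (τ.prodCongr τ) (fun p => by simp [s]) fun p _ => rfl
  let Dinv : C(E, ℂ) := ⟨fun y => (D y)⁻¹, D.continuous.inv₀ hD0⟩
  have hDinv_mem : Dinv ∈ pullbackRing q := hq.mem_pullbackRing hf fun Φ y =>
    congrArg (·⁻¹) (hDinv Φ y)
  refine eq_top_iff.2 fun β _ => ?_
  -- Only `Φ = 1` contributes: any other `Φ` moves some root `α j` to a different `α (σ Φ j)`, and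
  -- the factor at `(σ Φ j, j)` vanishes.
  have hsum : ∑ Φ : coveringTransformations q,
      transl Φ β * ∏ p ∈ s, (α p.1 - transl Φ (α p.2)) = β * D := by
    refine (Finset.sum_eq_single 1 (fun Φ _ hΦ => ?_) (by simp)).trans rfl
    have : ∃ j, σ Φ j ≠ j := by
      by_contra! h
      refine hΦ (hq.eq_of_transl_eq hf hα_inj hα fun i => ?_)
      rw [← hσ, h]
      rfl
    obtain ⟨j, hj⟩ := this
    rw [Finset.prod_eq_zero (i := (σ Φ j, j)) (by simp [s, hj]) (by rw [← hσ, sub_self]), mul_zero]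
  have hβ : β = Dinv * (β * D) := by
    ext y
    simp only [ContinuousMap.mul_apply, Dinv, ContinuousMap.coe_mk]
    field_simp [hD0 y]
  rw [hβ, ← hsum]
  exact mul_mem (adjoin_mem_of_mem_pullbackRing hDinv_mem _)
    (hq.sum_transl_mul_prod_mem_adjoin hf α s β)

/-- An automorphism over the base sends root values to root values of a point of the same fibre. -/
theorem IsSplittingCovering.exists_apply_eq_algEquiv (hf : IsWeierstrass f n)
    (hq : IsSplittingCovering f n q) (α : Fin n → C(E, ℂ))
    (θ : C(E, ℂ) ≃ₐ[pullbackRing q] C(E, ℂ)) (e : E) :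
    ∃ e', q e' = q e ∧ ∀ i, α i e' = θ (α i) e := by
  classical
  have := hq.pathConnected
  have := hq.finite_coveringTransformations hf
  have := Fintype.ofFinite (coveringTransformations q)
  by_contra! hne
  have hfix : ∀ b ∈ pullbackRing q, θ b = b := fun b hb => θ.commutes ⟨b, hb⟩
  let c (i : Fin n) : C(E, ℂ) := α i - ContinuousMap.const E (θ (α i) e)
  have hc i : θ (c i) e = 0 := by
    simp only [c, map_sub, ContinuousMap.sub_apply]
    rw [hfix (ContinuousMap.const E _) ⟨ContinuousMap.const X _, rfl⟩]
    simp
  -- The common zeros of the `c i` in the fibre are the points sought, and `g = ∑ |c i|²` detects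
  -- them. Although `θ` need not commute with `star`, `θ g` vanishes at `e` because each term keeps
  -- the factor `θ (c i)`.
  let g : C(E, ℂ) := ∑ i, star (c i) * c i
  have hg : θ g e = 0 := by
    simp [g, map_sum, ContinuousMap.sum_apply, hc]
  have hg_ne : ∀ e', q e' = q e → g e' ≠ 0 := fun e' he' h => by
    obtain ⟨i, hi⟩ := hne e' he'
    have hsum : ∑ i, Complex.normSq (c i e') = 0 := by
      have : g e' = ((∑ i, Complex.normSq (c i e') : ℝ) : ℂ) := by
        simp [g, ContinuousMap.sum_apply, Complex.normSq_eq_conj_mul_self]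
      rw [this] at h
      exact_mod_cast h
    have := (Finset.sum_eq_zero_iff_of_nonneg fun i _ => Complex.normSq_nonneg _).1 hsum i
      (Finset.mem_univ i)
    exact hi (sub_eq_zero.1 (Complex.normSq_eq_zero.1 this))
  -- The norm of `g` comes from the base, so `θ` fixes it; having `g` as a factor, it vanishes at
  -- `e`. Then `g` vanishes somewhere on the fibre of `e`, a contradiction.
  let N : C(E, ℂ) := ∏ Φ : coveringTransformations q, transl Φ g
  have hN_mem : N ∈ pullbackRing q := hq.mem_pullbackRing hf fun Ψ y => by
    simp only [N, ContinuousMap.prod_apply, transl_apply]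
    exact Fintype.prod_equiv (Equiv.mulRight Ψ) _ _ fun Φ => rfl
  have hN : N e = 0 := by
    rw [← hfix N hN_mem]
    simp only [N, map_prod, ContinuousMap.prod_apply]
    exact Finset.prod_eq_zero (Finset.mem_univ 1) hg
  simp only [N, ContinuousMap.prod_apply, Finset.prod_eq_zero_iff] at hN
  obtain ⟨Φ, -, hΦ⟩ := hN
  exact hg_ne _ (Φ.2 e) hΦ

theorem IsSplittingCovering.coveringTransformationsToAut_bijective (hf : IsWeierstrass f n)
    (hq : IsSplittingCovering f n q) : Function.Bijective (coveringTransformationsToAut q) := by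
  have := hq.pathConnected
  obtain ⟨α, hα_inj, hα⟩ := hq.splits
  refine ⟨fun Φ Ψ h => inv_injective (hq.eq_of_transl_eq hf hα_inj hα fun i =>
    DFunLike.congr_fun h (α i)), fun θ => ?_⟩
  have e : E := Classical.arbitrary E
  obtain ⟨e', hqe, he'⟩ := hq.exists_apply_eq_algEquiv hf α θ e
  obtain ⟨Φ, rfl⟩ := hq.exists_coveringTransformation hf hqe.symm
  have hθ i : IsRootFunction (pullbackPoly q f) (θ (α i)) := by
    have h := isRootFunction_pullbackPoly_iff_eval.1 (hα i)
    rw [isRootFunction_pullbackPoly_iff_eval]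
    rw [pullbackPoly, Polynomial.eval_map] at h ⊢
    have h' := congrArg θ h
    rw [map_zero] at h'
    rw [← h', Polynomial.eval₂_eq_sum, Polynomial.eval₂_eq_sum, Polynomial.sum,
      Polynomial.sum, map_sum]
    refine Finset.sum_congr rfl fun k _ => ?_
    rw [map_mul, map_pow]
    congr 1
    exact (θ.commutes ⟨_, f.coeff k, rfl⟩).symm
  -- The inverse appears because `θ` is `β ↦ β ∘ Φ`, whereas the action sends a transformation to
  -- composition with its inverse.
  refine ⟨Φ⁻¹, AlgEquiv.coe_toAlgHom_injective ?_⟩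
  refine AlgHom.ext_of_adjoin_eq_top (hq.adjoin_range_eq_top hf hα_inj hα) ?_
  rintro _ ⟨i, rfl⟩
  exact hf.root_eq_of_apply_eq q
    (isRootFunction_pullbackPoly.1 (isRootFunction_transl Φ (hα i)))
    (isRootFunction_pullbackPoly.1 (hθ i)) (he' i)

end Galois

end SemiTopGalois

theorem mainTheorem8 {X : Type u} [TopologicalSpace X] [T2Space X] [PathConnectedSpace X]
    [LocallyPathConnectedSpace X] (hX : SemiTopGalois.SemilocallySimplyConnected X)
    (n : ℕ) (f : C(X, ℂ)[X]) (hf : SemiTopGalois.IsWeierstrass f n)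
    {E : Type u} [TopologicalSpace E] (q : C(E, X))
    (hq : SemiTopGalois.IsSplittingCovering f n q)
    (α : Fin n → C(E, ℂ)) (hα_inj : Function.Injective α)
    (hα : ∀ i, SemiTopGalois.IsRootFunction (SemiTopGalois.pullbackPoly q f) (α i)) :
    Algebra.adjoin (SemiTopGalois.pullbackRing q) (Set.range α) = ⊤ ∧
    ∃ ω : SemiTopGalois.coveringTransformations q ≃*
        (C(E, ℂ) ≃ₐ[SemiTopGalois.pullbackRing q] C(E, ℂ)),
      ∀ (Φ : SemiTopGalois.coveringTransformations q) (β : C(E, ℂ)) (y : E),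
        ω Φ β y = β ((Φ : E ≃ₜ E).symm y) := by
  exact ⟨hq.adjoin_range_eq_top hf hα_inj hα, MulEquiv.ofBijective
    (SemiTopGalois.coveringTransformationsToAut q)
    (hq.coveringTransformationsToAut_bijective hf), SemiTopGalois.coveringTransformationsToAut_apply⟩
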